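/- Conventions. All rings are commutative. Two elements $a,b$ of an integral domain $R$ form an \emph{idempotent pair} if $(a\ b)$ or $(b\ a)$ is the first row of an idempotent $2\times 2$ matrix over $R$ (equivalently, $a(1-a)\in bR$ or $b(1-b)\in aR$). $R$ is a \emph{PRINC domain} if it is an integral domain in which every ideal generated by an idempotent pair is principal; it is \emph{seminormal} if whenever $a,b\in R$ and $a^2=b^3$ there is $c\in R$ with $c^3=a$ and $c^2=b$; it is \emph{projective-free} if every finitely generated projective $R$-module is free. Elements $c,d$ are \emph{comaximal} if $(c,d)=R$; a nonzero nonunit is \emph{pseudo-irreducible} if it is not a product of two comaximal nonunits; an integral domain $R$ is a \emph{comaximal factorization domain (CFD)} if every nonzero nonunit of $R$ is a product of pairwise comaximal pseudo-irreducible elements. A commutative (additive) monoid $S$ is \emph{pure} if it is isomorphic to a submonoid of $(\mathbb{Q}_{\ge 0},+)$, it is locally cyclic (for all $s_1,s_2\in S$ there is $s\in S$ with $\mathbb{N}s_1+\mathbb{N}s_2\subseteq \mathbb{N}s$), and for each $s\in S$ there is an integer $n>1$ with $s/n\in S$ (i.e. $s=nt$ for some $t\in S$). A pure monoid $S$ is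 \emph{$p$-pure} if for each $s\in S$ there is an integer $n>1$ that is not a power of $p$ with $s/n\in S$. $S$ is \emph{$p$-divisible} if $s/p\in S$ for every $s\in S$. $D[X;S]$ denotes the monoid ring of $S$ over $D$. \textbf{Theorem.} Let $D$ be a seminormal PRINC domain, of characteristic $\chi$, that is not projective-free. (i) Let $S\neq\{0\}$ be a pure monoid such that: (1) if $\chi=0$ and $S$ is $p$-divisible for some prime $p$, then $D\supseteq\mathbb{Z}[1/p]$ for some prime $p$ such that $S$ is $p$-divisible; (2) if $\chi=0$ and $S$ is $p$-divisible for no prime $p$, then $D\supseteq\mathbb{Q}$; (3) if $\chi\neq 0$, then $S$ is $\chi$-pure. Let $R=D[X;S]$. (ii) Let $R=D[X_n : n>0]/J$, where $J=(X_n-X_{n+1}(1+X_{n+1}) : n>0)$; that is, $R=\bigcup_{n>0}D[x_n]$, where $x_n$ is the class of $X_n$, so that $x_n=x_{n+1}(1+x_{n+1})$ for all $n>0$. In both cases (i) and (ii), $R$ is a PRINC domain that is neither a CFD nor projective-free. -/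

import Mathlib

/-- `a, b` is an idempotent pair if `(a b)` or `(b a)` is the first row of an idempotent
`2 × 2` matrix. -/
def IsIdempotentPair {R : Type*} [CommRing R] (a b : R) : Prop :=
  (∃ c d : R, IsIdempotentElem !![a, b; c, d]) ∨ (∃ c d : R, IsIdempotentElem !![b, a; c, d])

/-- A PRINC domain: an integral domain in which every ideal generated by an idempotent pair
is principal. -/
structure IsPRINCDomain (R : Type*) [CommRing R] : Prop where
  isDomain : IsDomain R
  isPrincipal : ∀ a b : R, IsIdempotentPair a b → (Ideal.span {a, b}).IsPrincipal

/-- Seminormality (in Swan's sense). -/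
def IsSeminormal (R : Type*) [CommRing R] : Prop :=
  ∀ a b : R, a ^ 2 = b ^ 3 → ∃ c : R, c ^ 3 = a ∧ c ^ 2 = b

/-- Every finitely generated projective module is free. A finitely generated module over
`R : Type u` is isomorphic to one in `Type u`, so no module is missed. -/
def IsProjectiveFree.{u} (R : Type u) [CommRing R] : Prop :=
  ∀ (M : Type u) [AddCommGroup M] [Module R M],
    Module.Finite R M → Module.Projective R M → Module.Free R M

/-- A nonzero nonunit that is not a product of two comaximal nonunits. -/
structure IsPseudoIrreducible {R : Type*} [CommRing R] (b : R) : Prop where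
  ne_zero : b ≠ 0
  not_isUnit : ¬ IsUnit b
  ne_mul : ∀ c d : R, IsCoprime c d → ¬ IsUnit c → ¬ IsUnit d → b ≠ c * d

/-- `b` is a product of pairwise comaximal pseudo-irreducible elements. -/
def HasCompleteComaximalFactorization {R : Type*} [CommRing R] (b : R) : Prop :=
  ∃ (m : ℕ) (f : Fin m → R), (∀ i, IsPseudoIrreducible (f i)) ∧
    (∀ i j, i ≠ j → IsCoprime (f i) (f j)) ∧ b = ∏ i, f i

/-- Comaximal factorization domain. -/
structure IsCFD (R : Type*) [CommRing R] : Prop where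
  isDomain : IsDomain R
  exists_factorization : ∀ b : R, b ≠ 0 → ¬ IsUnit b → HasCompleteComaximalFactorization b

/-- `S` is locally cyclic: any `s₁ ℕ + s₂ ℕ` is contained in some `s ℕ`. -/
def IsLocallyCyclicMonoid (S : Type*) [AddCommMonoid S] : Prop :=
  ∀ s₁ s₂ : S, ∃ s : S,
    AddSubmonoid.multiples s₁ ⊔ AddSubmonoid.multiples s₂ ≤ AddSubmonoid.multiples s

/-- A pure monoid: isomorphic to a submonoid of the nonnegative rationals, locally cyclic, and
every `s` is of the form `n • t` with `n > 1`. (The isomorphism transports the order of `ℚ≥0` to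
`S`; no other order on `S` is involved.) -/
structure IsPureMonoid (S : Type*) [AddCommMonoid S] : Prop where
  exists_embedding : ∃ f : S →+ ℚ≥0, Function.Injective f
  locallyCyclic : IsLocallyCyclicMonoid S
  exists_div : ∀ s : S, ∃ n : ℕ, 1 < n ∧ ∃ t : S, n • t = s

/-- A `p`-pure monoid: the integer `n > 1` dividing `s` can be chosen not to be a power of `p`. -/
structure IsPPureMonoid (p : ℕ) (S : Type*) [AddCommMonoid S] : Prop where
  isPure : IsPureMonoid S
  exists_div : ∀ s : S, ∃ n : ℕ, 1 < n ∧ (∀ k : ℕ, n ≠ p ^ k) ∧ ∃ t : S, n • t = s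

/-- `S` is `p`-divisible. -/
def IsPDivisibleMonoid (p : ℕ) (S : Type*) [AddCommMonoid S] : Prop :=
  ∀ s : S, ∃ t : S, p • t = s

/-- `D` contains (a copy of) `ℤ[1/p]`. -/
def ContainsIntInv (D : Type*) [CommRing D] (p : ℕ) : Prop :=
  ∃ f : Localization.Away (p : ℤ) →+* D, Function.Injective f

/-- `D` contains (a copy of) `ℚ`. -/
def ContainsRat (D : Type*) [CommRing D] : Prop :=
  ∃ f : ℚ →+* D, Function.Injective f

/-- The ideal of `D[X₀, X₁, …]` generated by the `Xₙ - Xₙ₊₁ (1 + Xₙ₊₁)`. -/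
noncomputable def towerIdeal (D : Type*) [CommRing D] : Ideal (MvPolynomial ℕ D) :=
  Ideal.span (Set.range fun n : ℕ =>
    (MvPolynomial.X n - MvPolynomial.X (n + 1) * (1 + MvPolynomial.X (n + 1)) :
      MvPolynomial ℕ D))

/-- The ring `⋃ D[xₙ]`, with `xₙ = xₙ₊₁ (1 + xₙ₊₁)`. The variables are numbered from `0`. -/
abbrev TowerRing (D : Type*) [CommRing D] : Type _ :=
  MvPolynomial ℕ D ⧸ towerIdeal D

/-- The class `xₙ` of the variable `Xₙ`. -/
noncomputable def TowerRing.x (D : Type*) [CommRing D] (n : ℕ) : TowerRing D :=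
  Ideal.Quotient.mk (towerIdeal D) (MvPolynomial.X n)

theorem TowerRing.x_eq (D : Type*) [CommRing D] (n : ℕ) :
    TowerRing.x D n = TowerRing.x D (n + 1) * (1 + TowerRing.x D (n + 1)) := by
  have h : (MvPolynomial.X n - MvPolynomial.X (n + 1) * (1 + MvPolynomial.X (n + 1)) :
      MvPolynomial ℕ D) ∈ towerIdeal D := Ideal.subset_span ⟨n, rfl⟩
  have h2 := (Ideal.Quotient.mk_eq_mk_iff_sub_mem _ _).2 h
  simpa [TowerRing.x] using h2

theorem TowerRing.adjoin_mono (D : Type*) [CommRing D] :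
    Monotone fun n => Algebra.adjoin D {TowerRing.x D n} := by
  refine monotone_nat_of_le_succ fun n => Algebra.adjoin_le ?_
  rintro _ rfl
  rw [TowerRing.x_eq D n]
  have h : TowerRing.x D (n + 1) ∈ Algebra.adjoin D {TowerRing.x D (n + 1)} :=
    Algebra.subset_adjoin rfl
  exact mul_mem h (add_mem (one_mem _) h)

/-- The ring is the union of its subrings `D[xₙ]`. -/
theorem TowerRing.exists_mem_adjoin (D : Type*) [CommRing D] (r : TowerRing D) :
    ∃ n, r ∈ Algebra.adjoin D {TowerRing.x D n} := by
  obtain ⟨q, rfl⟩ := Ideal.Quotient.mk_surjective r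
  induction q using MvPolynomial.induction_on with
  | C a => exact ⟨0, Subalgebra.algebraMap_mem _ a⟩
  | add p q hp hq =>
    obtain ⟨m, hm⟩ := hp
    obtain ⟨n, hn⟩ := hq
    refine ⟨max m n, ?_⟩
    rw [map_add]
    exact add_mem (TowerRing.adjoin_mono D (le_max_left m n) hm)
      (TowerRing.adjoin_mono D (le_max_right m n) hn)
  | mul_X p k hp =>
    obtain ⟨m, hm⟩ := hp
    refine ⟨max m k, ?_⟩
    rw [map_mul]
    exact mul_mem (TowerRing.adjoin_mono D (le_max_left m k) hm)
      (TowerRing.adjoin_mono D (le_max_right m k) (Algebra.subset_adjoin rfl))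

/-! A rank one idempotent matrix `!![a, b; c, 1 - a]` over a domain is a column times a row exactly
when the ideal `(a, b)` is principal. This condition involves finitely many elements and passes
along ring maps. Both rings are directed unions of copies of `D[X]`, so the PRINC property reduces
to `D[X]`.

For `D[X]` the argument is Traverso–Swan in rank one. Conjugation by a matrix of determinant 1 over
`D` makes the value at `0` equal to `!![1, 0; 0, 0]`. Over the fraction field, `K[X]` is a PID, and
a factorization exists with both vectors equal to `(1, 0)` at `0`. Its coefficients are integral
over `D` and generate a finite extension `B`. Seminormality makes the conductor radical. At a
minimal prime `P` of its contraction, localizing `B` modulo the conductor gives a reduced algebra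
over the residue field of `P`. Normalised factorizations over a reduced ring are unique, so the
coefficients already come from that field. Hence `B` agrees with `D` at `P`, which is impossible
unless `B = D`.

In a PRINC domain a pseudo-irreducible element dividing a product of two comaximal elements divides
one of them. A CFD therefore cannot contain elements that split comaximally forever, as `X^s - 1`
and `xₙ` do. Finally `D` is a retract of each ring, and projective-freeness descends to retracts. -/

open Polynomial

/-! ### Idempotent pairs and rank one idempotent matrices -/

/-- The matrix `!![a, b; c, 1 - a]` is a column times a row. -/
def IsOuterProduct {R : Type*} [CommRing R] (a b c : R) : Prop :=
  ∃ f₁ f₂ g₁ g₂ : R, a = f₁ * g₁ ∧ b = f₁ * g₂ ∧ c = f₂ * g₁ ∧ 1 - a = f₂ * g₂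

theorem isIdempotentElem_fin_two_iff {R : Type*} [CommRing R] {a b c d : R} :
    IsIdempotentElem !![a, b; c, d] ↔
      a * a + b * c = a ∧ a * b + b * d = b ∧ c * a + d * c = c ∧ c * b + d * d = d := by
  unfold IsIdempotentElem
  rw [Matrix.mul_fin_two, ← Matrix.ext_iff]
  simp [Fin.forall_fin_two, and_assoc]

theorem isIdempotentPair_iff {R : Type*} [CommRing R] {a b : R} :
    IsIdempotentPair a b ↔ b ∣ a * (1 - a) ∨ a ∣ b * (1 - b) := by
  have key : ∀ a b : R, (∃ c d : R, IsIdempotentElem !![a, b; c, d]) ↔ b ∣ a * (1 - a) := by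
    intro a b
    simp only [isIdempotentElem_fin_two_iff]
    constructor
    · rintro ⟨c, d, h, -⟩
      exact ⟨c, by linear_combination -h⟩
    · rintro ⟨c, h⟩
      exact ⟨c, 1 - a, by linear_combination -h, by ring, by ring, by linear_combination -h⟩
  rw [IsIdempotentPair, key, key]

/-- A generator of `(a, b)` is the common factor of the first row, and conversely `f₁` generates
`(a, b)`. The equational form is the one that transfers along ring maps. -/
theorem isPRINCDomain_iff {R : Type*} [CommRing R] :
    IsPRINCDomain R ↔
      IsDomain R ∧ ∀ a b c : R, a * (1 - a) = b * c → IsOuterProduct a b c := by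
  constructor
  · rintro ⟨hR, hP⟩
    refine ⟨hR, fun a b c h => ?_⟩
    obtain ⟨⟨f, hf⟩⟩ := hP a b (isIdempotentPair_iff.2 (Or.inl ⟨c, h⟩))
    rw [Ideal.submodule_span_eq] at hf
    have ha : a ∈ Ideal.span {f} := hf ▸ Ideal.subset_span (by simp)
    have hb : b ∈ Ideal.span {f} := hf ▸ Ideal.subset_span (by simp)
    have hf' : f ∈ Ideal.span {a, b} := hf ▸ Ideal.mem_span_singleton_self f
    obtain ⟨g₁, rfl⟩ := Ideal.mem_span_singleton.1 ha
    obtain ⟨g₂, rfl⟩ := Ideal.mem_span_singleton.1 hb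
    obtain ⟨r, s, hrs⟩ := Ideal.mem_span_pair.1 hf'
    by_cases f0 : f = 0
    · subst f0
      -- Here `a = b = 0`, so the matrix is `!![0, 0; c, 1]`.
      exact ⟨0, 1, c, 1, by simp, by simp, by simp, by simp⟩
    · have h1 : r * g₁ + s * g₂ = 1 := mul_left_cancel₀ f0 (by linear_combination hrs)
      have h2 : g₁ * (1 - f * g₁) = g₂ * c := mul_left_cancel₀ f0 (by linear_combination h)
      -- Since `r * g₁ + s * g₂ = 1`, pairing a multiple of the row `(g₁, g₂)` with `(r, s)`
      -- recovers the multiplier; `f₂` is the second row paired with `(r, s)`.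
      refine ⟨f, r * c + s * (1 - f * g₁), g₁, g₂, rfl, rfl, ?_, ?_⟩
      · linear_combination (-c) * h1 - s * h2
      · linear_combination (-(1 - f * g₁)) * h1 + r * h2
  · rintro ⟨hR, hP⟩
    have key : ∀ a b : R, b ∣ a * (1 - a) → (Ideal.span {a, b}).IsPrincipal := by
      rintro a b ⟨c, h⟩
      obtain ⟨f₁, f₂, g₁, g₂, h1, h2, h3, h4⟩ := hP a b c h
      refine ⟨⟨f₁, ?_⟩⟩
      rw [Ideal.submodule_span_eq]
      apply le_antisymm
      · rw [Ideal.span_le]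
        rintro x (rfl | rfl)
        · exact Ideal.mem_span_singleton.2 ⟨g₁, h1⟩
        · exact Ideal.mem_span_singleton.2 ⟨g₂, h2⟩
      · rw [Ideal.span_singleton_le_iff_mem, Ideal.mem_span_pair]
        exact ⟨f₁, f₂, by linear_combination f₂ * h2 - f₁ * h4⟩
    refine ⟨hR, fun a b h => ?_⟩
    obtain h | h := isIdempotentPair_iff.1 h
    · exact key a b h
    · rw [Set.pair_comm]
      exact key b a h

theorem IsOuterProduct.map {R S : Type*} [CommRing R] [CommRing S] (φ : R →+* S) {a b c : R}
    (h : IsOuterProduct a b c) : IsOuterProduct (φ a) (φ b) (φ c) := by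
  obtain ⟨f₁, f₂, g₁, g₂, h1, h2, h3, h4⟩ := h
  refine ⟨φ f₁, φ f₂, φ g₁, φ g₂, ?_, ?_, ?_, ?_⟩
  · simp [h1]
  · simp [h2]
  · simp [h3]
  · rw [← map_one φ, ← map_sub, h4, map_mul]

theorem isPRINCDomain_of_isPrincipalIdealRing (R : Type*) [CommRing R] [IsDomain R]
    [IsPrincipalIdealRing R] : IsPRINCDomain R :=
  ⟨inferInstance, fun _ _ _ => IsPrincipalIdealRing.principal _⟩

/-! ### Normalised factorizations: existence, uniqueness, integrality -/

/-- Over a field, a matrix `!![a, b; c, 1 - a]` of polynomials with value `!![1, 0; 0, 0]` at `0`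
is an outer product in a normalised way. -/
theorem exists_normalised_outerProduct {K : Type*} [Field K] {a b c : K[X]}
    (h : a * (1 - a) = b * c) (ha : a.coeff 0 = 1) (hb : b.coeff 0 = 0) (hc : c.coeff 0 = 0) :
    ∃ f₁ f₂ g₁ g₂ : K[X], (a = f₁ * g₁ ∧ b = f₁ * g₂ ∧ c = f₂ * g₁ ∧ 1 - a = f₂ * g₂) ∧
      f₁.coeff 0 = 1 ∧ f₂.coeff 0 = 0 ∧ g₁.coeff 0 = 1 ∧ g₂.coeff 0 = 0 := by
  obtain ⟨f₁, f₂, g₁, g₂, h1, h2, h3, h4⟩ :=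
    (isPRINCDomain_iff.1 (isPRINCDomain_of_isPrincipalIdealRing K[X])).2 a b c h
  have e : f₁.coeff 0 * g₁.coeff 0 = 1 := by rw [← mul_coeff_zero, ← h1, ha]
  have e2 : f₁.coeff 0 * g₂.coeff 0 = 0 := by rw [← mul_coeff_zero, ← h2, hb]
  have e3 : f₂.coeff 0 * g₁.coeff 0 = 0 := by rw [← mul_coeff_zero, ← h3, hc]
  have hf : f₁.coeff 0 ≠ 0 := left_ne_zero_of_mul_eq_one e
  have hg : g₁.coeff 0 ≠ 0 := right_ne_zero_of_mul_eq_one e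
  have hC : (C (f₁.coeff 0) : K[X]) * C (g₁.coeff 0) = 1 := by rw [← C_mul, e, C_1]
  -- The column is rescaled by `g₁(0)` and the row by its inverse `f₁(0)`.
  refine ⟨C (g₁.coeff 0) * f₁, C (g₁.coeff 0) * f₂, C (f₁.coeff 0) * g₁, C (f₁.coeff 0) * g₂,
    ⟨?_, ?_, ?_, ?_⟩, ?_, ?_, ?_, ?_⟩
  · linear_combination h1 - f₁ * g₁ * hC
  · linear_combination h2 - f₁ * g₂ * hC
  · linear_combination h3 - f₂ * g₁ * hC
  · linear_combination h4 - f₂ * g₂ * hC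
  · rw [coeff_C_mul, mul_comm, e]
  · rw [coeff_C_mul, mul_comm, e3]
  · rw [coeff_C_mul, e]
  · rw [coeff_C_mul, e2]

/-- Over a reduced ring, normalised outer product decompositions are unique. -/
theorem normalised_outerProduct_unique {C : Type*} [CommRing C] [IsReduced C]
    {f₁ f₂ g₁ g₂ f₁' f₂' g₁' g₂' : C[X]} (h11 : f₁ * g₁ = f₁' * g₁') (h12 : f₁ * g₂ = f₁' * g₂')
    (h21 : f₂ * g₁ = f₂' * g₁') (h22 : f₂ * g₂ = f₂' * g₂') (ht : f₁ * g₁ + f₂ * g₂ = 1)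
    (hg₁ : g₁.coeff 0 = 1) (hg₂ : g₂.coeff 0 = 0) (hf₁' : f₁'.coeff 0 = 1) :
    f₁ = f₁' ∧ f₂ = f₂' ∧ g₁ = g₁' ∧ g₂ = g₂' := by
  have ht' : f₁' * g₁' + f₂' * g₂' = 1 := by rw [← h11, ← h22, ht]
  -- Each row is paired with the other column; the product of the two pairings is the trace of the
  -- square of the common idempotent matrix, which is 1.
  have huv : (g₁ * f₁' + g₂ * f₂') * (g₁' * f₁ + g₂' * f₂) = 1 := by
    calc _ = g₁ * f₁ * (f₁' * g₁') + g₁ * f₂ * (f₁' * g₂') + g₂ * f₁ * (f₂' * g₁')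
          + g₂ * f₂ * (f₂' * g₂') := by ring
      _ = (f₁ * g₁ + f₂ * g₂) * (f₁ * g₁ + f₂ * g₂) := by
        rw [← h11, ← h12, ← h21, ← h22]; ring
      _ = 1 := by rw [ht, one_mul]
  -- A unit of `C[X]` with `C` reduced is constant, and the value at `0` is 1.
  have hu : g₁ * f₁' + g₂ * f₂' = 1 := by
    have h := (isUnit_iff_coeff_isUnit_isNilpotent.1 (IsUnit.of_mul_eq_one _ huv)).2
    ext i
    rcases eq_or_ne i 0 with rfl | hi
    · simp [mul_coeff_zero, hg₁, hg₂, hf₁']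
    · rw [(h i hi).eq_zero, coeff_one, if_neg hi]
  refine ⟨?_, ?_, ?_, ?_⟩
  · linear_combination (-f₁) * hu + f₁' * h11 + f₂' * h12 + f₁' * ht'
  · linear_combination (-f₂) * hu + f₁' * h21 + f₂' * h22 + f₂' * ht'
  · linear_combination g₁' * hu + g₁ * h11 + g₂ * h21 - g₁ * ht
  · linear_combination g₂' * hu + g₁ * h12 + g₂ * h22 - g₂ * ht

/-- Reversal turns constant term 1 into leading coefficient 1, and a monic factor over `K` of a
monic polynomial over `A` has integral coefficients. -/
theorem isIntegral_coeff_of_mul_eq_map {A K : Type*} [CommRing A] [Field K] [Algebra A K]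
    [FaithfulSMul A K] {a : A[X]} {f g : K[X]} (h : f * g = a.map (algebraMap A K))
    (ha : a.coeff 0 = 1) (hf : f.coeff 0 = 1) (n : ℕ) : IsIntegral A (f.coeff n) := by
  have hinj := FaithfulSMul.algebraMap_injective A K
  have : Nontrivial A := (algebraMap A K).domain_nontrivial
  have hmap : a.reverse.map (algebraMap A K) = (a.map (algebraMap A K)).reverse := by
    ext i
    simp [coeff_reverse, natDegree_map_eq_of_injective hinj]
  have hdvd : f.reverse ∣ a.reverse.map (algebraMap A K) :=
    ⟨g.reverse, by rw [hmap, ← h, reverse_mul_of_domain]⟩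
  have hl := (lifts_iff_coeff_lifts _).1 (integralClosure.mem_lifts_of_monic_of_dvd_map K
    (by
      have h0 : a.coeff 0 ≠ 0 := by simp [ha]
      rw [Monic, reverse_leadingCoeff, trailingCoeff_eq_coeff_zero h0, ha])
    (by
      have h0 : f.coeff 0 ≠ 0 := by simp [hf]
      rw [Monic, reverse_leadingCoeff, trailingCoeff_eq_coeff_zero h0, hf]) hdvd)
  obtain ⟨y, hy⟩ := hl (revAt f.natDegree n)
  rw [coeff_reverse, revAt_invol] at hy
  exact hy ▸ y.2

/-- As `g` has constant term 1, the `n`-th coefficient of `f` is that of `f * g` minus products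
involving lower coefficients of `f`. -/
theorem isIntegral_coeff_of_mul_right {A K : Type*} [CommRing A] [CommRing K] [Algebra A K]
    {f g : K[X]} (hfg : ∀ n, IsIntegral A ((f * g).coeff n)) (hg : ∀ n, IsIntegral A (g.coeff n))
    (h0 : g.coeff 0 = 1) (n : ℕ) : IsIntegral A (f.coeff n) := by
  induction n using Nat.strong_induction_on with
  | _ n ih =>
    have h := hfg n
    rw [coeff_mul, ← Finset.add_sum_erase _ _ (show (n, 0) ∈ Finset.HasAntidiagonal.antidiagonal n by simp)] at h
    simp only [h0, mul_one] at h
    rw [← add_sub_cancel_right (f.coeff n)]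
    refine h.sub (IsIntegral.sum _ fun p hp => ?_)
    rw [Finset.mem_erase, Finset.HasAntidiagonal.mem_antidiagonal] at hp
    refine (ih _ ?_).mul (hg _)
    rcases p with ⟨i, j⟩
    have : j ≠ 0 := by
      rintro rfl
      exact hp.1 (by simpa using hp.2)
    simp only at hp ⊢
    omega

universe u v

/-! ### The conductor and its minimal primes -/

/-- The largest ideal of `B` contained in the image of `A`. -/
def rangeConductor (A B : Type*) [CommRing A] [CommRing B] [Algebra A B] : Ideal B where
  carrier := {x | ∀ y, x * y ∈ (algebraMap A B).range}
  zero_mem' := fun y => by rw [zero_mul]; exact zero_mem _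
  add_mem' := fun {x x'} hx hx' y => by rw [add_mul]; exact add_mem (hx y) (hx' y)
  smul_mem' := fun r x hx y => by
    rw [smul_eq_mul, mul_comm r, mul_assoc]
    exact hx _

/-- Seminormality gives `c` in `A` with `c ^ 2 = x ^ 2` and `c ^ 3 = x ^ 3`, and cancelling `x ^ 2`
yields `c = x`. -/
theorem IsSeminormal.mem_range {A B : Type*} [CommRing A] [CommRing B] [IsDomain B] [Algebra A B]
    [FaithfulSMul A B] (hA : IsSeminormal A) {x : B} (h2 : x ^ 2 ∈ (algebraMap A B).range)
    (h3 : x ^ 3 ∈ (algebraMap A B).range) : x ∈ (algebraMap A B).range := by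
  obtain ⟨α, hα⟩ := h2
  obtain ⟨β, hβ⟩ := h3
  obtain ⟨c, hc3, hc2⟩ := hA β α (FaithfulSMul.algebraMap_injective A B (by
    rw [map_pow, map_pow, hα, hβ]; ring))
  rcases eq_or_ne x 0 with rfl | hx
  · exact zero_mem _
  · refine ⟨c, mul_left_cancel₀ (pow_ne_zero 2 hx) ?_⟩
    have e2 : algebraMap A B c ^ 2 = x ^ 2 := by rw [← map_pow, hc2, hα]
    have e3 : algebraMap A B c ^ 3 = x ^ 3 := by rw [← map_pow, hc3, hβ]
    linear_combination e3 - algebraMap A B c * e2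

/-- If `x ^ 2` is in the conductor, then the square and the cube of every `x * y` come from `A`,
hence so does `x * y`. -/
theorem IsSeminormal.rangeConductor_isRadical {A B : Type*} [CommRing A] [CommRing B] [IsDomain B]
    [Algebra A B] [FaithfulSMul A B] (hA : IsSeminormal A) : (rangeConductor A B).IsRadical := by
  rw [Ideal.isRadical_iff_pow_one_lt 2 one_lt_two]
  intro x hx y
  have h2 : (x * y) ^ 2 ∈ rangeConductor A B := by
    rw [mul_pow]
    exact Ideal.mul_mem_right _ _ hx
  refine hA.mem_range ?_ ?_
  · simpa using h2 1
  · rw [pow_succ]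
    exact h2 _

/-- The localization of `B / J` at a minimal prime `P` of `J ∩ A`, for a radical ideal `J` of
`B`, is reduced, and elements of `P` are zero in it. -/
theorem exists_reduced_localization {A : Type*} {B : Type u} [CommRing A] [CommRing B]
    (η : A →+* B) {J : Ideal B} (hJ : J.IsRadical) {P : Ideal A}
    (hP : P ∈ (J.comap η).minimalPrimes) :
    ∃ (C : Type u) (_ : CommRing C) (_ : IsReduced C) (ψ : B →+* C),
      (∀ y, ψ y = 0 → ∃ t ∉ P, η t * y ∈ J) ∧ (∀ s ∉ P, IsUnit (ψ (η s))) ∧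
      ∀ x ∈ P, ψ (η x) = 0 := by
  have hPp : P.IsPrime := hP.1.1
  have : IsReduced (B ⧸ J) := (Ideal.isRadical_iff_quotient_reduced _).1 hJ
  let M : Submonoid (B ⧸ J) := P.primeCompl.map ((Ideal.Quotient.mk J).comp η)
  let ψ : B →+* Localization M := (algebraMap (B ⧸ J) (Localization M)).comp (Ideal.Quotient.mk J)
  have hunit : ∀ s ∉ P, IsUnit (ψ (η s)) := fun s hs =>
    IsLocalization.map_units (Localization M) (⟨_, s, hs, rfl⟩ : M)
  refine ⟨Localization M, inferInstance, inferInstance, ψ, fun y hy => ?_, hunit, fun x hx => ?_⟩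
  · obtain ⟨⟨_, t, ht, rfl⟩, hm⟩ := (IsLocalization.map_eq_zero_iff M (Localization M)
      (Ideal.Quotient.mk J y)).1 hy
    refine ⟨t, ht, Ideal.Quotient.eq_zero_iff_mem.1 ?_⟩
    rw [map_mul]
    exact hm
  -- By minimality of `P`, some `s * x ^ n` with `s ∉ P` lies in the contraction of `J`; reducedness
  -- then kills `x`.
  · have hx' : algebraMap A (Localization.AtPrime P) x ∈
        ((J.comap η).map (algebraMap A (Localization.AtPrime P))).radical := by
      rw [IsLocalization.AtPrime.radical_map_of_mem_minimalPrimes (Localization.AtPrime P) P _ hP]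
      exact Ideal.mem_map_of_mem _ hx
    obtain ⟨n, hn⟩ := hx'
    rw [← map_pow, IsLocalization.algebraMap_mem_map_algebraMap_iff P.primeCompl] at hn
    obtain ⟨s, hs, hsn⟩ := hn
    have h0 : ψ (η s) * ψ (η x) ^ n = 0 := by
      rw [← map_pow, ← map_pow, ← map_mul, ← map_mul]
      change algebraMap (B ⧸ J) (Localization M) (Ideal.Quotient.mk J _) = 0
      rw [Ideal.Quotient.eq_zero_iff_mem.2 (Ideal.mem_comap.1 hsn), map_zero]
    exact eq_zero_of_pow_eq_zero ((hunit s hs).mul_right_eq_zero.1 h0)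

/-- A homomorphism to a ring where the elements of a prime ideal `P` are zero and all other
elements are units factors through the residue field. -/
theorem exists_residueField_lift {A C : Type*} [CommRing A] [CommRing C] (P : Ideal A)
    [hPp : P.IsPrime] (φ : A →+* C) (hunit : ∀ s ∉ P, IsUnit (φ s)) (hker : ∀ x ∈ P, φ x = 0) :
    ∃ (ι : A →+* P.ResidueField) (κ : P.ResidueField →+* C), κ.comp ι = φ ∧
      ∀ z, ∃ α, ∃ s ∉ P, z * ι s = ι α := by
  let θ : A ⧸ P →+* C := Ideal.Quotient.lift P φ hker
  have hθ : ∀ y : nonZeroDivisors (A ⧸ P), IsUnit (θ y) := by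
    rintro ⟨y, hy⟩
    obtain ⟨s, rfl⟩ := Ideal.Quotient.mk_surjective y
    exact hunit s fun hs => nonZeroDivisors.ne_zero hy (Ideal.Quotient.eq_zero_iff_mem.2 hs)
  refine ⟨(algebraMap (A ⧸ P) P.ResidueField).comp (Ideal.Quotient.mk P),
    IsLocalization.lift hθ, ?_, fun z => ?_⟩
  · ext x
    exact IsLocalization.lift_eq (S := P.ResidueField) hθ (Ideal.Quotient.mk P x)
  · obtain ⟨⟨α, s, hs⟩, hz⟩ := IsLocalization.surj (nonZeroDivisors (A ⧸ P)) z
    obtain ⟨α, rfl⟩ := Ideal.Quotient.mk_surjective α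
    obtain ⟨s, rfl⟩ := Ideal.Quotient.mk_surjective s
    exact ⟨α, s, fun h => nonZeroDivisors.ne_zero hs (Ideal.Quotient.eq_zero_iff_mem.2 h), hz⟩

/-- If the minimal prime `P` contains the conductor, then the coefficients of a normalised outer
product decomposition over `B` lie in the image of `A` after localization at `P`. -/
theorem exists_mul_coeff_mem_range {A B : Type*} [CommRing A] [CommRing B] [IsDomain B]
    [Algebra A B] [FaithfulSMul A B] (hA : IsSeminormal A) {P : Ideal A}
    (hP : P ∈ ((rangeConductor A B).comap (algebraMap A B)).minimalPrimes)
    {a b c : A[X]} (h : a * (1 - a) = b * c)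
    (ha : a.coeff 0 = 1) (hb : b.coeff 0 = 0) (hc : c.coeff 0 = 0) {f₁ f₂ g₁ g₂ : B[X]}
    (h11 : a.map (algebraMap A B) = f₁ * g₁) (h12 : b.map (algebraMap A B) = f₁ * g₂)
    (h21 : c.map (algebraMap A B) = f₂ * g₁) (h22 : 1 - a.map (algebraMap A B) = f₂ * g₂)
    (hg₁ : g₁.coeff 0 = 1) (hg₂ : g₂.coeff 0 = 0) :
    ∀ f ∈ ({f₁, f₂, g₁, g₂} : Set B[X]), ∀ n, ∃ s ∉ P,
      algebraMap A B s * f.coeff n ∈ (algebraMap A B).range := by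
  have hPp : P.IsPrime := hP.1.1
  obtain ⟨C, _, _, ψ, hψ, hunit, hker⟩ :=
    exists_reduced_localization (algebraMap A B) hA.rangeConductor_isRadical hP
  obtain ⟨ι, κ, hκι, hsurj⟩ := exists_residueField_lift P (ψ.comp (algebraMap A B)) hunit hker
  -- If `x` becomes a fraction `α / s` in the localization, then `t * (s * x - α)` lies in the
  -- conductor for some `t ∉ P`, and the conductor is contained in the image of `A`.
  have key : ∀ (x : B) (z : P.ResidueField), ψ x = κ z →
      ∃ s ∉ P, algebraMap A B s * x ∈ (algebraMap A B).range := by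
    intro x z hxz
    obtain ⟨α, s, hsP, hz⟩ := hsurj z
    have hz' : κ z * ψ (algebraMap A B s) = ψ (algebraMap A B α) := by
      rw [← RingHom.comp_apply ψ, ← RingHom.comp_apply ψ, ← hκι, RingHom.comp_apply,
        RingHom.comp_apply, ← map_mul, hz]
    obtain ⟨t, ht, hmem⟩ := hψ (x * algebraMap A B s - algebraMap A B α) (by
      rw [map_sub, map_mul, hxz]
      exact sub_eq_zero.2 hz')
    refine ⟨t * s, fun h => (hPp.mem_or_mem h).elim ht hsP, ?_⟩
    have e : algebraMap A B (t * s) * x =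
        algebraMap A B t * (x * algebraMap A B s - algebraMap A B α) * 1 +
          algebraMap A B (t * α) := by
      rw [map_mul, map_mul]; ring
    rw [e]
    exact add_mem (hmem 1) ⟨_, rfl⟩
  obtain ⟨f₁', f₂', g₁', g₂', ⟨h11', h12', h21', h22'⟩, hf₁', -, -, -⟩ :=
    exists_normalised_outerProduct (a := a.map ι) (b := b.map ι) (c := c.map ι)
      (by simpa using congrArg (Polynomial.map ι) h) (by simp [ha]) (by simp [hb]) (by simp [hc])
  have hmap : ∀ p : A[X], (p.map (algebraMap A B)).map ψ = (p.map ι).map κ := by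
    intro p
    rw [Polynomial.map_map, Polynomial.map_map, hκι]
  have e22 : (1 - a.map (algebraMap A B)).map ψ = (1 - a.map ι).map κ := by
    rw [Polynomial.map_sub, Polynomial.map_sub, hmap, Polynomial.map_one, Polynomial.map_one]
  obtain ⟨e1, e2, e3, e4⟩ := normalised_outerProduct_unique
    (f₁ := f₁.map ψ) (f₂ := f₂.map ψ) (g₁ := g₁.map ψ) (g₂ := g₂.map ψ)
    (f₁' := f₁'.map κ) (f₂' := f₂'.map κ) (g₁' := g₁'.map κ) (g₂' := g₂'.map κ)
    (by rw [← Polynomial.map_mul, ← Polynomial.map_mul, ← h11, ← h11', hmap])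
    (by rw [← Polynomial.map_mul, ← Polynomial.map_mul, ← h12, ← h12', hmap])
    (by rw [← Polynomial.map_mul, ← Polynomial.map_mul, ← h21, ← h21', hmap])
    (by rw [← Polynomial.map_mul, ← Polynomial.map_mul, ← h22, ← h22', e22])
    (by
      rw [← Polynomial.map_mul, ← Polynomial.map_mul, ← h22, ← h11, ← Polynomial.map_add]
      simp)
    (by simp [hg₁]) (by simp [hg₂]) (by simp [hf₁'])
  have fin : ∀ (f : B[X]) (f' : P.ResidueField[X]), f.map ψ = f'.map κ → ∀ n, ∃ s ∉ P,
      algebraMap A B s * f.coeff n ∈ (algebraMap A B).range := by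
    intro f f' hf n
    refine key _ (f'.coeff n) ?_
    rw [← coeff_map, hf, coeff_map]
  rintro f (rfl | rfl | rfl | rfl)
  exacts [fin _ _ e1, fin _ _ e2, fin _ _ e3, fin _ _ e4]

/-- If the localization of `B` at every minimal prime of the conductor comes from `A`, then so
does `B`. -/
theorem algebraMap_surjective_of_minimalPrimes {A B : Type*} [CommRing A] [CommRing B]
    [Algebra A B] [Module.Finite A B] {T : Set B} (hT : Algebra.adjoin A T = ⊤)
    (h : ∀ P ∈ ((rangeConductor A B).comap (algebraMap A B)).minimalPrimes, ∀ x ∈ T,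
      ∃ s ∉ P, algebraMap A B s * x ∈ (algebraMap A B).range) :
    Function.Surjective (algebraMap A B) := by
  by_contra hs
  have hne : (rangeConductor A B).comap (algebraMap A B) ≠ ⊤ := by
    intro htop
    have h1 : (1 : A) ∈ (rangeConductor A B).comap (algebraMap A B) := htop ▸ trivial
    refine hs fun y => ?_
    have := h1 y
    rwa [map_one, one_mul] at this
  obtain ⟨P, hP⟩ := Ideal.nonempty_minimalPrimes hne
  have hPp : P.IsPrime := hP.1.1
  have hall : ∀ x : B, ∃ s ∉ P, algebraMap A B s * x ∈ (algebraMap A B).range := by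
    intro x
    have hx : x ∈ Algebra.adjoin A T := hT ▸ trivial
    induction hx using Algebra.adjoin_induction with
    | mem x hx => exact h P hP x hx
    | algebraMap r => exact ⟨1, (Ideal.ne_top_iff_one P).1 hPp.ne_top, by simp⟩
    | add x y _ _ hx hy =>
      obtain ⟨s, hs, hsx⟩ := hx
      obtain ⟨t, ht, hty⟩ := hy
      refine ⟨s * t, fun h => (hPp.mem_or_mem h).elim hs ht, ?_⟩
      have e : algebraMap A B (s * t) * (x + y) =
          algebraMap A B t * (algebraMap A B s * x) + algebraMap A B s * (algebraMap A B t * y) := by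
        rw [map_mul]; ring
      rw [e]
      exact add_mem (mul_mem ⟨_, rfl⟩ hsx) (mul_mem ⟨_, rfl⟩ hty)
    | mul x y _ _ hx hy =>
      obtain ⟨s, hs, hsx⟩ := hx
      obtain ⟨t, ht, hty⟩ := hy
      refine ⟨s * t, fun h => (hPp.mem_or_mem h).elim hs ht, ?_⟩
      have e : algebraMap A B (s * t) * (x * y) =
          (algebraMap A B s * x) * (algebraMap A B t * y) := by
        rw [map_mul]; ring
      rw [e]
      exact mul_mem hsx hty
  classical
  obtain ⟨G, hG⟩ := Module.Finite.fg_top (R := A) (M := B)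
  choose s hsP hsx using hall
  -- The product of the denominators of finitely many module generators lies in the contracted
  -- conductor, hence in `P`.
  have hmem : ∏ x ∈ G, s x ∈ (rangeConductor A B).comap (algebraMap A B) := by
    intro y
    have hy : y ∈ Submodule.span A (G : Set B) := hG ▸ trivial
    induction hy using Submodule.span_induction with
    | mem x hx =>
      rw [← Finset.prod_erase_mul _ _ hx, map_mul, mul_assoc]
      exact mul_mem ⟨_, rfl⟩ (hsx x)
    | zero => rw [mul_zero]; exact zero_mem _
    | add x y _ _ hx hy => rw [mul_add]; exact add_mem hx hy
    | smul r x _ hx => rw [mul_smul_comm, Algebra.smul_def]; exact mul_mem ⟨_, rfl⟩ hx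
  obtain ⟨x, -, hx⟩ := (Ideal.IsPrime.prod_mem_iff (hp := hPp)).1 (hP.1.2 hmem)
  exact hsP x hx

/-! ### Polynomial rings over seminormal PRINC domains -/

/-- Over a polynomial ring `A[X]` with `A` a seminormal domain, a matrix `!![a, b; c, 1 - a]` of
determinant zero with value `!![1, 0; 0, 0]` at `0` is an outer product. -/
theorem IsSeminormal.isOuterProduct_of_coeff_zero {A : Type*} [CommRing A] [IsDomain A]
    (hA : IsSeminormal A) {a b c : A[X]} (h : a * (1 - a) = b * c)
    (ha : a.coeff 0 = 1) (hb : b.coeff 0 = 0) (hc : c.coeff 0 = 0) : IsOuterProduct a b c := by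
  let K := FractionRing A
  obtain ⟨f₁, f₂, g₁, g₂, ⟨h11, h12, h21, h22⟩, hf₁, hf₂, hg₁, hg₂⟩ :=
    exists_normalised_outerProduct (a := a.map (algebraMap A K)) (b := b.map (algebraMap A K))
      (c := c.map (algebraMap A K)) (by simpa using congrArg (Polynomial.map (algebraMap A K)) h)
      (by simp [ha]) (by simp [hb]) (by simp [hc])
  have hcoeff : ∀ (p : A[X]) n, IsIntegral A ((p.map (algebraMap A K)).coeff n) := by
    intro p n
    rw [coeff_map]
    exact isIntegral_algebraMap
  -- Reversal handles `f₁` and `g₁`, whose constant terms are 1; `f₂` and `g₂` vanish at `0` and are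
  -- reached from `c = f₂ * g₁` and `b = f₁ * g₂`.
  have i1 := isIntegral_coeff_of_mul_eq_map h11.symm ha hf₁
  have i3 := isIntegral_coeff_of_mul_eq_map (mul_comm f₁ g₁ ▸ h11.symm) ha hg₁
  have i2 := isIntegral_coeff_of_mul_right (h21 ▸ hcoeff c) i3 hg₁
  have i4 := isIntegral_coeff_of_mul_right (mul_comm f₁ g₂ ▸ h12 ▸ hcoeff b) i1 hf₁
  let T : Set K := f₁.coeffs ∪ f₂.coeffs ∪ g₁.coeffs ∪ g₂.coeffs
  have hTi : ∀ x ∈ T, IsIntegral A x := by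
    rintro x (((hx | hx) | hx) | hx) <;> obtain ⟨n, -, rfl⟩ := mem_coeffs_iff.1 hx
    exacts [i1 n, i2 n, i3 n, i4 n]
  have hTf : T.Finite := by
    simp only [T, Set.finite_union, Finset.finite_toSet, and_self]
  let B := Algebra.adjoin A T
  have : Module.Finite A B := Algebra.finite_adjoin_of_finite_of_isIntegral hTf hTi
  have hlift : ∀ f : K[X], (f.coeffs : Set K) ⊆ T → ∃ f' : B[X], f'.map (algebraMap B K) = f := by
    intro f hf
    rw [← mem_lifts, lifts_iff_coeff_lifts]
    intro n
    by_cases h0 : f.coeff n = 0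
    · exact ⟨0, by rw [h0, map_zero]⟩
    · exact ⟨⟨_, Algebra.subset_adjoin (hf (coeff_mem_coeffs h0))⟩, rfl⟩
  obtain ⟨f₁', hf₁'⟩ := hlift f₁ fun x hx => Or.inl (Or.inl (Or.inl hx))
  obtain ⟨f₂', hf₂'⟩ := hlift f₂ fun x hx => Or.inl (Or.inl (Or.inr hx))
  obtain ⟨g₁', hg₁'⟩ := hlift g₁ fun x hx => Or.inl (Or.inr hx)
  obtain ⟨g₂', hg₂'⟩ := hlift g₂ fun x hx => Or.inr hx
  have hinj : Function.Injective (algebraMap B K) := Subtype.val_injective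
  have hminj := Polynomial.map_injective _ hinj
  have hcomp : ∀ p : A[X], (p.map (algebraMap A B)).map (algebraMap B K) =
      p.map (algebraMap A K) := fun p => by rw [Polynomial.map_map]; rfl
  have h11' : a.map (algebraMap A B) = f₁' * g₁' := hminj (by
    rw [hcomp, Polynomial.map_mul, hf₁', hg₁', h11])
  have h12' : b.map (algebraMap A B) = f₁' * g₂' := hminj (by
    rw [hcomp, Polynomial.map_mul, hf₁', hg₂', h12])
  have h21' : c.map (algebraMap A B) = f₂' * g₁' := hminj (by
    rw [hcomp, Polynomial.map_mul, hf₂', hg₁', h21])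
  have h22' : 1 - a.map (algebraMap A B) = f₂' * g₂' := hminj (by
    rw [Polynomial.map_sub, hcomp, Polynomial.map_mul, hf₂', hg₂', Polynomial.map_one, h22])
  have hg₁0 : g₁'.coeff 0 = 1 := hinj (by rw [← coeff_map, hg₁', hg₁, map_one])
  have hg₂0 : g₂'.coeff 0 = 0 := hinj (by rw [← coeff_map, hg₂', hg₂, map_zero])
  have hsurj : Function.Surjective (algebraMap A B) := by
    refine algebraMap_surjective_of_minimalPrimes (T := ((↑) : B → K) ⁻¹' T) ?_ ?_
    · exact Algebra.adjoin_adjoin_coe_preimage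
    · intro P hP x hx
      have key := exists_mul_coeff_mem_range hA hP h ha hb hc h11' h12' h21' h22' hg₁0 hg₂0
      have hx' : ∃ f ∈ ({f₁', f₂', g₁', g₂'} : Set B[X]), ∃ n, f.coeff n = x := by
        have hx : (x : K) ∈ T := hx
        have hc : ∀ {f : K[X]} {f' : B[X]}, f'.map (algebraMap B K) = f → (x : K) ∈ f.coeffs →
            ∃ n, f'.coeff n = x := by
          rintro f f' rfl hx
          obtain ⟨n, -, hn⟩ := mem_coeffs_iff.1 hx
          exact ⟨n, hinj (by rw [← coeff_map]; exact hn.symm)⟩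
        obtain ((hx | hx) | hx) | hx := hx
        exacts [⟨f₁', by simp, hc hf₁' hx⟩, ⟨f₂', by simp, hc hf₂' hx⟩, ⟨g₁', by simp, hc hg₁' hx⟩,
          ⟨g₂', by simp, hc hg₂' hx⟩]
      obtain ⟨f, hf, n, rfl⟩ := hx'
      exact key f hf n
  have hbij : Function.Bijective (algebraMap A B) :=
    ⟨FaithfulSMul.algebraMap_injective A B, hsurj⟩
  let e := RingEquiv.ofBijective (algebraMap A B) hbij
  have hmap : ∀ p : A[X], (p.map (algebraMap A B)).map (e.symm : B →+* A) = p := by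
    intro p
    rw [Polynomial.map_map]
    convert Polynomial.map_id
    ext x
    exact e.symm_apply_apply x
  have hout : IsOuterProduct (a.map (algebraMap A B)) (b.map (algebraMap A B))
      (c.map (algebraMap A B)) := ⟨_, _, _, _, h11', h12', h21', h22'⟩
  simpa only [coe_mapRingHom, hmap] using hout.map (mapRingHom (e.symm : B →+* A))

/-- A polynomial ring over a seminormal PRINC domain is a PRINC domain. -/
theorem IsPRINCDomain.polynomial {A : Type*} [CommRing A] (hP : IsPRINCDomain A)
    (hA : IsSeminormal A) : IsPRINCDomain A[X] := by
  have := hP.isDomain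
  refine isPRINCDomain_iff.2 ⟨inferInstance, fun a b c h => ?_⟩
  obtain ⟨u₁, u₂, w₁, w₂, h1, h2, h3, h4⟩ := (isPRINCDomain_iff.1 hP).2
    (a.coeff 0) (b.coeff 0) (c.coeff 0) (by simpa [mul_coeff_zero] using congrArg (coeff · 0) h)
  have hdet : u₁ * w₁ + u₂ * w₂ = 1 := by linear_combination -h1 - h4
  have hdetC : (C u₁ * C w₁ + C u₂ * C w₂ : A[X]) = 1 := by
    rw [← C_mul, ← C_mul, ← C_add, hdet, C_1]
  -- Conjugation by `!![u₁, -w₂; u₂, w₁]`, of determinant 1, carries the value at `0`, which is the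
  -- column `u` times the row `w`, to `!![1, 0; 0, 0]`.
  have key := hA.isOuterProduct_of_coeff_zero
    (a := C u₁ * (C w₁ * a + C w₂ * c) + C u₂ * (C w₁ * b + C w₂ * (1 - a)))
    (b := -C w₂ * (C w₁ * a + C w₂ * c) + C w₁ * (C w₁ * b + C w₂ * (1 - a)))
    (c := C u₁ * (-C u₂ * a + C u₁ * c) + C u₂ * (-C u₂ * b + C u₁ * (1 - a)))
    (by
      linear_combination (C u₁ * C w₁ + C u₂ * C w₂) ^ 2 * h -
        (C u₁ * (C w₁ * a + C w₂ * c) + C u₂ * (C w₁ * b + C w₂ * (1 - a))) * hdetC)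
    (by
      simp only [coeff_add, coeff_sub, coeff_C_mul, coeff_one_zero]
      linear_combination u₁ * w₁ * h1 + u₁ * w₂ * h3 + u₂ * w₁ * h2 + u₂ * w₂ * h4 +
        (u₁ * w₁ + u₂ * w₂ + 1) * hdet)
    (by
      simp only [coeff_add, coeff_sub, neg_mul, coeff_neg, coeff_C_mul, coeff_one_zero]
      linear_combination w₁ ^ 2 * h2 - w₂ * w₁ * h1 - w₂ ^ 2 * h3 + w₁ * w₂ * h4)
    (by
      simp only [coeff_add, coeff_sub, neg_mul, coeff_neg, coeff_C_mul, coeff_one_zero]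
      linear_combination u₁ ^ 2 * h3 - u₁ * u₂ * h1 - u₂ ^ 2 * h2 + u₂ * u₁ * h4)
  obtain ⟨f₁, f₂, g₁, g₂, e1, e2, e3, e4⟩ := key
  refine ⟨C u₁ * f₁ - C w₂ * f₂, C u₂ * f₁ + C w₁ * f₂, C w₁ * g₁ - C u₂ * g₂,
    C w₂ * g₁ + C u₁ * g₂, ?_, ?_, ?_, ?_⟩
  · linear_combination C u₁ * C w₁ * e1 - C u₁ * C u₂ * e2 - C w₂ * C w₁ * e3 +
      C w₂ * C u₂ * e4 - (a * (C u₁ * C w₁ + C u₂ * C w₂ + 1) - C w₂ * C u₂) * hdetC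
  · linear_combination C u₁ * C w₂ * e1 + C u₁ * C u₁ * e2 - C w₂ * C w₂ * e3 -
      C w₂ * C u₁ * e4 - (b * (C u₁ * C w₁ + C u₂ * C w₂ + 1) + C w₂ * C u₁) * hdetC
  · linear_combination C u₂ * C w₁ * e1 - C u₂ * C u₂ * e2 + C w₁ * C w₁ * e3 -
      C w₁ * C u₂ * e4 - (c * (C u₁ * C w₁ + C u₂ * C w₂ + 1) + C w₁ * C u₂) * hdetC
  · linear_combination C u₂ * C w₂ * e1 + C u₂ * C u₁ * e2 + C w₁ * C w₂ * e3 +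
      C w₁ * C u₁ * e4 - ((1 - a) * (C u₁ * C w₁ + C u₂ * C w₂ + 1) - C w₁ * C u₁) * hdetC

/-! ### Directed unions of polynomial rings, and retracts -/

/-- Every finite set of elements of `R` lies in a subalgebra that is a polynomial ring in one
variable over `D`. -/
def IsDirectedUnionOfPolynomials (D : Type u) (R : Type v) [CommRing D] [CommRing R]
    [Algebra D R] : Prop :=
  ∀ F : Finset R, ∃ φ : D[X] →ₐ[D] R, Function.Injective φ ∧ ∀ x ∈ F, x ∈ φ.range

namespace IsDirectedUnionOfPolynomials

variable {D : Type u} {R : Type v} [CommRing D] [CommRing R] [Algebra D R]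

theorem isDomain [IsDomain D] (h : IsDirectedUnionOfPolynomials D R) : IsDomain R := by
  classical
  have : Nontrivial R := by
    obtain ⟨φ, hφ, -⟩ := h ∅
    exact hφ.nontrivial
  have : NoZeroDivisors R := by
    refine ⟨fun {a b} hab => ?_⟩
    obtain ⟨φ, hφ, hF⟩ := h {a, b}
    obtain ⟨p, rfl⟩ := hF a (by simp)
    obtain ⟨q, rfl⟩ := hF b (by simp)
    change φ p * φ q = 0 at hab
    rw [← map_mul, map_eq_zero_iff φ hφ, mul_eq_zero] at hab
    exact hab.imp (fun h => by simp [h]) (fun h => by simp [h])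
  exact NoZeroDivisors.to_isDomain R

theorem isPRINCDomain (h : IsDirectedUnionOfPolynomials D R) (hD : IsPRINCDomain D)
    (hsn : IsSeminormal D) : IsPRINCDomain R := by
  classical
  have := hD.isDomain
  refine isPRINCDomain_iff.2 ⟨h.isDomain, fun a b c habc => ?_⟩
  obtain ⟨φ, hφ, hF⟩ := h {a, b, c}
  obtain ⟨p, rfl⟩ := hF a (by simp)
  obtain ⟨q, rfl⟩ := hF b (by simp)
  obtain ⟨r, rfl⟩ := hF c (by simp)
  refine IsOuterProduct.map (φ : D[X] →+* R) ((isPRINCDomain_iff.1 (hD.polynomial hsn)).2 p q r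
    (hφ ?_))
  simpa using habc

theorem exists_eq_algebraMap_of_isUnit [IsDomain D] (h : IsDirectedUnionOfPolynomials D R) {r : R}
    (hr : IsUnit r) : ∃ d, r = algebraMap D R d := by
  classical
  obtain ⟨r', hr'⟩ := hr.exists_right_inv
  obtain ⟨φ, hφ, hF⟩ := h {r, r'}
  obtain ⟨p, rfl⟩ := hF r (by simp)
  obtain ⟨q, rfl⟩ := hF r' (by simp)
  have hpq : p * q = 1 := hφ (by rw [map_mul, map_one]; exact hr')
  obtain ⟨d, -, rfl⟩ := Polynomial.isUnit_iff.1 (IsUnit.of_mul_eq_one _ hpq)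
  exact ⟨d, φ.commutes d⟩

end IsDirectedUnionOfPolynomials

/-- A retract of a projective-free ring is projective-free. -/
theorem IsProjectiveFree.of_retract {D : Type u} {R : Type (max u v)} [CommRing D] [CommRing R]
    [Algebra D R] (ε : R →ₐ[D] D) (h : IsProjectiveFree R) : IsProjectiveFree D := by
  intro M _ _ _ _
  let : Algebra R D := ε.toRingHom.toAlgebra
  have : IsScalarTower D R D := IsScalarTower.of_algebraMap_eq fun d => (ε.commutes d).symm
  have : Module.Free R (TensorProduct D R M) := h _ inferInstance inferInstance
  have : Module.Free D (TensorProduct R D (TensorProduct D R M)) := inferInstance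
  -- Extending `M` to `R` and then back along `ε` returns `M`.
  exact Module.Free.of_equiv ((TensorProduct.AlgebraTensorModule.cancelBaseChange D R D D M).trans
    (TensorProduct.lid D M))

/-! ### Obstruction to comaximal factorization -/

/-- In a PRINC domain, pseudo-irreducible elements behave like primes with respect to products of
comaximal elements. -/
theorem IsPseudoIrreducible.dvd_or_dvd {R : Type*} [CommRing R] (hR : IsPRINCDomain R) {f c d : R}
    (hf : IsPseudoIrreducible f) (hcd : IsCoprime c d) (h : f ∣ c * d) : f ∣ c ∨ f ∣ d := by
  obtain ⟨u, v, huv⟩ := hcd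
  obtain ⟨w, hw⟩ := h
  -- `u * c` and `f` form an idempotent pair because `1 - u * c = v * d`. The resulting
  -- factorization `f = f₁ * g₂` is comaximal, so one factor is a unit.
  obtain ⟨f₁, f₂, g₁, g₂, h1, h2, -, h4⟩ := (isPRINCDomain_iff.1 hR).2 (u * c) f (u * v * w)
    (by linear_combination u * v * hw - u * c * huv)
  have hcop : IsCoprime f₁ g₂ := ⟨g₁, f₂, by linear_combination -h1 - h4⟩
  by_cases hu : IsUnit f₁
  · right
    have hdvd : f ∣ v * d := by
      rw [h2, hu.mul_left_dvd]
      exact ⟨f₂, by linear_combination h4 + huv⟩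
    have e : d = (v * d) * d + u * (f * w) := by linear_combination (-d) * huv + u * hw
    rw [e]
    exact dvd_add (hdvd.mul_right _) ((dvd_mul_right f w).mul_left _)
  · left
    have hu' : IsUnit g₂ := by
      by_contra hg
      exact hf.ne_mul _ _ hcop hu hg h2
    have hdvd : f ∣ u * c := by
      rw [h2, hu'.mul_right_dvd, h1]
      exact dvd_mul_right _ _
    have e : c = (u * c) * c + v * (f * w) := by linear_combination (-c) * huv + v * hw
    rw [e]
    exact dvd_add (hdvd.mul_right _) ((dvd_mul_right f w).mul_left _)

/-- A PRINC domain is not a CFD if it has a nonempty set of nonzero elements from each of which a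
nonunit factor can be split off comaximally, with cofactor in the set. -/
theorem IsPRINCDomain.not_isCFD {R : Type*} [CommRing R] (hR : IsPRINCDomain R) (P : Set R)
    (hne : P.Nonempty) (h0 : 0 ∉ P)
    (hP : ∀ b ∈ P, ∃ c d, b = c * d ∧ IsCoprime c d ∧ ¬ IsUnit c ∧ d ∈ P) : ¬ IsCFD R := by
  classical
  intro hcfd
  obtain ⟨b, hb⟩ := hne
  have hbu : ¬ IsUnit b := by
    obtain ⟨c, d, rfl, -, hc, -⟩ := hP b hb
    exact fun h => hc (isUnit_of_mul_isUnit_left h)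
  obtain ⟨m, f, hf, -, hbf⟩ := hcfd.exists_factorization b (fun h => h0 (h ▸ hb)) hbu
  -- Each splitting `b = c * d` leaves `d` dividing the product of the `f i` that divide `d`. These
  -- are strictly fewer, since otherwise the nonunit `c` would be coprime to a multiple of itself.
  have key : ∀ (s : Finset (Fin m)), ∀ b ∈ P, b ∣ ∏ i ∈ s, f i → (∀ i ∈ s, f i ∣ b) → False := by
    intro s
    induction s using Finset.strongInduction with
    | _ s ih =>
      intro b hb hbs hsb
      obtain ⟨c, d, rfl, hcd, hc, hd⟩ := hP b hb
      refine ih (s.filter fun i => f i ∣ d) ?_ d hd ?_ fun i hi => (Finset.mem_filter.1 hi).2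
      · rw [Finset.filter_ssubset]
        by_contra! hall
        refine hc (IsCoprime.isUnit_of_dvd' (IsCoprime.prod_right fun i hi => ?_) dvd_rfl
          ((dvd_mul_right c d).trans hbs))
        exact hcd.of_isCoprime_of_dvd_right (hall i hi)
      · rw [← Finset.prod_filter_mul_prod_filter_not s fun i => f i ∣ d] at hbs
        refine IsCoprime.dvd_of_dvd_mul_right ?_ ((dvd_mul_left d c).trans hbs)
        refine IsCoprime.prod_right fun i hi => ?_
        rw [Finset.mem_filter] at hi
        exact hcd.symm.of_isCoprime_of_dvd_right
          (((hf i).dvd_or_dvd hR hcd (hsb i hi.1)).resolve_right hi.2)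
  exact key Finset.univ b hb hbf.dvd fun i hi => hbf ▸ Finset.dvd_prod_of_mem f hi

/-! ### Monoid rings of pure monoids -/

theorem IsPureMonoid.nsmul_left_injective {S : Type*} [AddCommMonoid S] (hS : IsPureMonoid S)
    {s : S} (hs : s ≠ 0) : Function.Injective fun n : ℕ => n • s := by
  obtain ⟨f, hf⟩ := hS.exists_embedding
  have hfs : f s ≠ 0 := (map_ne_zero_iff f hf).2 hs
  intro m n hmn
  have h := congrArg f (show m • s = n • s from hmn)
  rw [map_nsmul, map_nsmul, nsmul_eq_mul, nsmul_eq_mul] at h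
  exact_mod_cast mul_right_cancel₀ hfs h

theorem IsLocallyCyclicMonoid.exists_forall_mem_multiples {S : Type*} [AddCommMonoid S]
    (hS : IsLocallyCyclicMonoid S) (F : Finset S) :
    ∃ s : S, ∀ x ∈ F, x ∈ AddSubmonoid.multiples s := by
  classical
  induction F using Finset.induction_on with
  | empty => exact ⟨0, by simp⟩
  | insert a F _ ih =>
    obtain ⟨s, hs⟩ := ih
    obtain ⟨t, ht⟩ := hS a s
    refine ⟨t, fun x hx => ?_⟩
    rcases Finset.mem_insert.1 hx with rfl | hx
    · exact ht (AddSubmonoid.mem_sup_left (AddSubmonoid.mem_multiples x))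
    · exact ht (AddSubmonoid.mem_sup_right (hs x hx))

namespace AddMonoidAlgebra

variable {D S : Type*} [CommRing D] [AddCommMonoid S]

theorem aeval_single_injective {s : S} (hs : Function.Injective fun n : ℕ => n • s) :
    Function.Injective (aeval (R := D) (single s 1 : AddMonoidAlgebra D S)) := by
  classical
  have key : ∀ (p : D[X]) (n : ℕ), (aeval (single s 1 : AddMonoidAlgebra D S) p).coeff (n • s) =
      p.coeff n := by
    intro p n
    induction p using Polynomial.induction_on' with
    | add p q hp hq => simp [hp, hq]
    | monomial m a =>
      rw [aeval_monomial, single_pow, coe_algebraMap, Function.comp_apply, single_mul_single,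
        coeff_single, Finsupp.single_apply, coeff_monomial]
      simp [hs.eq_iff]
  intro p q hpq
  ext n
  rw [← key, ← key, hpq]

theorem mem_range_aeval_single {s : S} {r : AddMonoidAlgebra D S}
    (h : ∀ x ∈ r.coeff.support, x ∈ AddSubmonoid.multiples s) :
    r ∈ (aeval (R := D) (single s 1 : AddMonoidAlgebra D S)).range := by
  rw [← sum_coeff_single r]
  refine sum_mem fun x hx => ?_
  obtain ⟨n, rfl⟩ := h x hx
  refine ⟨monomial n (r.coeff (n • s)), ?_⟩
  simp [aeval_monomial, single_mul_single]

theorem isDirectedUnionOfPolynomials [Nontrivial S] (hS : IsPureMonoid S) :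
    IsDirectedUnionOfPolynomials D (AddMonoidAlgebra D S) := by
  classical
  intro F
  obtain ⟨s₀, hs₀⟩ := exists_ne (0 : S)
  -- The nonzero element `s₀` is included to force `s ≠ 0`.
  obtain ⟨s, hs⟩ := hS.locallyCyclic.exists_forall_mem_multiples
    (insert s₀ (F.biUnion fun r => r.coeff.support))
  have hs0 : s ≠ 0 := by
    rintro rfl
    obtain ⟨n, hn⟩ := hs s₀ (Finset.mem_insert_self _ _)
    exact hs₀ (by simpa using hn.symm)
  refine ⟨aeval (single s 1), aeval_single_injective (hS.nsmul_left_injective hs0), fun r hr => ?_⟩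
  exact mem_range_aeval_single fun x hx =>
    hs x (Finset.mem_insert_of_mem (Finset.mem_biUnion.2 ⟨r, hr, hx⟩))

/-- `X^(nt) - 1` is `X^t - 1` times a geometric sum congruent to `n` modulo `X^t - 1`; the factors
are comaximal when `n` is a unit. -/
theorem not_isCFD [Nontrivial S] (hD : IsPRINCDomain D) (hsn : IsSeminormal D)
    (hS : IsPureMonoid S)
    (hdiv : ∀ s : S, ∃ n : ℕ, 1 < n ∧ IsUnit (n : D) ∧ ∃ t : S, n • t = s) :
    ¬ IsCFD (AddMonoidAlgebra D S) := by
  classical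
  have := hD.isDomain
  have hR := isDirectedUnionOfPolynomials (D := D) hS
  obtain ⟨s₀, hs₀⟩ := exists_ne (0 : S)
  refine (hR.isPRINCDomain hD hsn).not_isCFD
    {r | ∃ s : S, s ≠ 0 ∧ r = single s 1 - 1} ⟨_, s₀, hs₀, rfl⟩ ?_ ?_
  · rintro ⟨s, hs, h⟩
    have h' := congrArg (fun r => r.coeff s) h
    simp [one_def, hs.symm] at h'
  · rintro _ ⟨s, hs, rfl⟩
    obtain ⟨n, hn, hu, t, rfl⟩ := hdiv s
    have ht : t ≠ 0 := by
      rintro rfl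
      exact hs (smul_zero n)
    have hfac : (∑ i ∈ Finset.range n, (single t 1 : AddMonoidAlgebra D S) ^ i) *
        (single t 1 - 1) = single (n • t) 1 - 1 := by
      rw [geom_sum_mul, single_pow, one_pow]
    refine ⟨_, _, hfac.symm, ?_, ?_, t, ht, rfl⟩
    · obtain ⟨w, hw⟩ : (single t 1 - 1 : AddMonoidAlgebra D S) ∣
          (∑ i ∈ Finset.range n, (single t 1 : AddMonoidAlgebra D S) ^ i) - n := by
        have e : (∑ i ∈ Finset.range n, (single t 1 : AddMonoidAlgebra D S) ^ i) - n =
            ∑ i ∈ Finset.range n, ((single t 1 : AddMonoidAlgebra D S) ^ i - 1) := by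
          simp [Finset.sum_sub_distrib]
        rw [e]
        exact Finset.dvd_sum fun i _ => sub_one_dvd_pow_sub_one _ i
      obtain ⟨y, hy⟩ := (hu.map (algebraMap D (AddMonoidAlgebra D S))).exists_left_inv
      rw [map_natCast] at hy
      exact ⟨y, -(y * w), by linear_combination y * hw + hy⟩
    -- A unit is a constant, and a constant times `X^t - 1` has no term in degree `n • t` because `n
    -- > 1`.
    · intro hunit
      obtain ⟨d, hd⟩ := hR.exists_eq_algebraMap_of_isUnit hunit
      rw [hd] at hfac
      have h' := congrArg (fun r => r.coeff (n • t)) hfac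
      have hinj := hS.nsmul_left_injective ht
      have h1 : t ≠ n • t := fun h => hn.ne (hinj (by simpa using h))
      have h2 : (0 : S) ≠ n • t := fun h => hs h.symm
      simp [one_def, single_mul_single, mul_sub, h1, h2] at h'

end AddMonoidAlgebra

theorem exists_isUnit_natCast_div {D S : Type*} [CommRing D] [IsDomain D] [AddCommMonoid S]
    (hS : IsPureMonoid S)
    (h1 : ringChar D = 0 → (∃ p : ℕ, p.Prime ∧ IsPDivisibleMonoid p S) →
      ∃ p : ℕ, p.Prime ∧ IsPDivisibleMonoid p S ∧ ContainsIntInv D p)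
    (h2 : ringChar D = 0 → (∀ p : ℕ, p.Prime → ¬ IsPDivisibleMonoid p S) → ContainsRat D)
    (h3 : ringChar D ≠ 0 → IsPPureMonoid (ringChar D) S) (s : S) :
    ∃ n : ℕ, 1 < n ∧ IsUnit (n : D) ∧ ∃ t : S, n • t = s := by
  by_cases hχ : ringChar D = 0
  · by_cases hp : ∃ p : ℕ, p.Prime ∧ IsPDivisibleMonoid p S
    · obtain ⟨p, hp, hdiv, f, -⟩ := h1 hχ hp
      refine ⟨p, hp.one_lt, ?_, hdiv s⟩
      have h := (IsLocalization.Away.algebraMap_isUnit (S := Localization.Away (p : ℤ))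
        (p : ℤ)).map f
      simpa using h
    · obtain ⟨f, -⟩ := h2 hχ fun p hp' hd => hp ⟨p, hp', hd⟩
      obtain ⟨n, hn, ht⟩ := hS.exists_div s
      have h : IsUnit (n : ℚ) := IsUnit.mk0 _ (by exact_mod_cast (by omega : n ≠ 0))
      exact ⟨n, hn, by simpa using h.map f, ht⟩
  · have hprime : (ringChar D).Prime :=
      (CharP.char_is_prime_or_zero D (ringChar D)).resolve_right hχ
    obtain ⟨n, hn, hpow, t, rfl⟩ := (h3 hχ).exists_div s
    -- In characteristic `χ > 0` the divisor is replaced by its prime-to-`χ` part, which is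
    -- invertible, and is not 1 because `n` is not a power of `χ`.
    obtain ⟨k, m, hm, rfl⟩ := Nat.exists_eq_pow_mul_and_not_dvd (by omega : n ≠ 0)
      (ringChar D) hprime.ne_one
    refine ⟨m, ?_, ?_, ringChar D ^ k • t, ?_⟩
    · have hm0 : m ≠ 0 := by
        rintro rfl
        exact hm (dvd_zero _)
      have hm1 : m ≠ 1 := by
        rintro rfl
        exact hpow k (mul_one _)
      omega
    · have hcop : IsCoprime (m : ℤ) (ringChar D : ℤ) :=
        Nat.isCoprime_iff_coprime.2 ((hprime.coprime_iff_not_dvd.2 hm).symm)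
      obtain ⟨x, y, hxy⟩ := hcop
      have h := congrArg (Int.cast : ℤ → D) hxy
      push_cast at h
      rw [ringChar.Nat.cast_ringChar, mul_zero, add_zero] at h
      exact IsUnit.of_mul_eq_one_right _ h
    · rw [smul_smul, mul_comm]

/-! ### The ring `⋃ D[xₙ]` -/

namespace TowerRing

variable {D : Type*} [CommRing D]

/-- Over an algebraically closed field, any `xₙ` can be given any value. -/
theorem exists_algHom_x_eq {L : Type*} [Field L] [IsAlgClosed L] [Algebra D L] (n : ℕ) (l : L) :
    ∃ φ : TowerRing D →ₐ[D] L, φ (x D n) = l := by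
  let h : L → L := fun y => y * (1 + y)
  have hsurj : Function.Surjective h := by
    intro z
    obtain ⟨y, hy⟩ := IsAlgClosed.exists_root (X ^ 2 + X - C z : L[X]) (by
      have : (X ^ 2 + X - C z : L[X]).degree = 2 := by compute_degree!
      rw [this]
      exact two_ne_zero)
    refine ⟨y, ?_⟩
    simp only [IsRoot, eval_sub, eval_add, eval_pow, eval_X, eval_C] at hy
    simp only [h]
    linear_combination hy
  choose g hg using hsurj
  have hgl : ∀ m, h^[m] (g^[m] l) = l := fun m =>
    (Function.LeftInverse.iterate (f := g) (g := h) hg m) l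
  have hstep : ∀ m, h^[n] (g^[m] l) = h (h^[n] (g^[m + 1] l)) := by
    intro m
    rw [← Function.iterate_succ_apply' h, Function.iterate_succ_apply h,
      Function.iterate_succ_apply' g, hg]
  -- With `g` a section of `h`, this formula satisfies the relations for all `m`, below and above
  -- `n`, and gives `l` at `m = n`.
  let ψ : MvPolynomial ℕ D →ₐ[D] L := MvPolynomial.aeval fun m => h^[n] (g^[m] l)
  refine ⟨Ideal.Quotient.liftₐ (towerIdeal D) ψ ?_, ?_⟩
  · intro a ha
    have hle : towerIdeal D ≤ RingHom.ker ψ := by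
      refine Ideal.span_le.2 ?_
      rintro _ ⟨m, rfl⟩
      simp only [SetLike.mem_coe, RingHom.mem_ker, map_sub, map_mul, map_add, map_one, ψ,
        MvPolynomial.aeval_X]
      rw [hstep m, sub_self]
    exact hle ha
  · change ψ (MvPolynomial.X n) = l
    simp [ψ, hgl]

theorem isDirectedUnionOfPolynomials [IsDomain D] :
    IsDirectedUnionOfPolynomials D (TowerRing D) := by
  classical
  intro F
  choose n hn using exists_mem_adjoin D
  refine ⟨aeval (x D (F.sup n)), ?_, fun r hr => ?_⟩
  -- Sending `xₙ` to the variable `X` in an algebraic closure of the field of rational functions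
  -- shows that `xₙ` is transcendental.
  · let L := AlgebraicClosure (FractionRing D[X])
    obtain ⟨φ, hφ⟩ := exists_algHom_x_eq (D := D) (F.sup n) (algebraMap D[X] L X)
    have hinj : Function.Injective (φ.comp (aeval (x D (F.sup n)))) := by
      have e : φ.comp (aeval (x D (F.sup n))) = IsScalarTower.toAlgHom D D[X] L := by
        ext
        simp [hφ]
      rw [e]
      rw [IsScalarTower.coe_toAlgHom', IsScalarTower.algebraMap_eq D[X] (FractionRing D[X]) L]
      exact (algebraMap (FractionRing D[X]) L).injective.comp (IsFractionRing.injective D[X] _)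
    exact Function.Injective.of_comp (f := φ) (by simpa using hinj)
  · rw [← Algebra.adjoin_singleton_eq_range_aeval]
    exact adjoin_mono D (Finset.le_sup hr) (hn r)

theorem exists_algHom : Nonempty (TowerRing D →ₐ[D] D) := by
  refine ⟨Ideal.Quotient.liftₐ (towerIdeal D) (MvPolynomial.aeval 0) fun a ha => ?_⟩
  have hle : towerIdeal D ≤ RingHom.ker (MvPolynomial.aeval (R := D) (0 : ℕ → D)) := by
    refine Ideal.span_le.2 ?_
    rintro _ ⟨m, rfl⟩
    simp
  exact hle ha

/-- The comaximal splitting is `xₙ = (1 + xₙ₊₁) * xₙ₊₁`. Specializing `xₙ` to 1 shows it is nonzero,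
and `xₙ₊₁` to -1 shows that `1 + xₙ₊₁` is not a unit. -/
theorem not_isCFD (hD : IsPRINCDomain D) (hsn : IsSeminormal D) : ¬ IsCFD (TowerRing D) := by
  have := hD.isDomain
  let L := AlgebraicClosure (FractionRing D)
  refine (isDirectedUnionOfPolynomials.isPRINCDomain hD hsn).not_isCFD
    (Set.range (x D)) ⟨_, 0, rfl⟩ ?_ ?_
  · rintro ⟨n, hn⟩
    obtain ⟨φ, hφ⟩ := exists_algHom_x_eq (D := D) (L := L) n 1
    rw [hn, map_zero] at hφ
    exact zero_ne_one hφ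
  · rintro _ ⟨n, rfl⟩
    refine ⟨1 + x D (n + 1), x D (n + 1), by rw [x_eq D n, mul_comm], ⟨1, -1, by ring⟩, ?_, _, rfl⟩
    intro hu
    obtain ⟨φ, hφ⟩ := exists_algHom_x_eq (D := D) (L := L) (n + 1) (-1)
    refine (hu.map φ).ne_zero ?_
    rw [map_add, map_one, hφ, add_neg_cancel]

end TowerRing

theorem mainTheorem9 {D : Type*} [CommRing D] (hD : IsPRINCDomain D) (hsn : IsSeminormal D)
    (hpf : ¬ IsProjectiveFree D) :
    (∀ (S : Type*) [AddCommMonoid S] [Nontrivial S], IsPureMonoid S →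
      (ringChar D = 0 → (∃ p : ℕ, p.Prime ∧ IsPDivisibleMonoid p S) →
        ∃ p : ℕ, p.Prime ∧ IsPDivisibleMonoid p S ∧ ContainsIntInv D p) →
      (ringChar D = 0 → (∀ p : ℕ, p.Prime → ¬ IsPDivisibleMonoid p S) → ContainsRat D) →
      (ringChar D ≠ 0 → IsPPureMonoid (ringChar D) S) →
      IsPRINCDomain (AddMonoidAlgebra D S) ∧ ¬ IsCFD (AddMonoidAlgebra D S) ∧
        ¬ IsProjectiveFree (AddMonoidAlgebra D S)) ∧
    (IsPRINCDomain (TowerRing D) ∧ ¬ IsCFD (TowerRing D) ∧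
      ¬ IsProjectiveFree (TowerRing D)) := by
  have := hD.isDomain
  refine ⟨fun S _ _ hS h1 h2 h3 => ⟨?_, ?_, fun h => hpf ?_⟩, ?_, ?_, fun h => hpf ?_⟩
  · exact (AddMonoidAlgebra.isDirectedUnionOfPolynomials hS).isPRINCDomain hD hsn
  · exact AddMonoidAlgebra.not_isCFD hD hsn hS (exists_isUnit_natCast_div hS h1 h2 h3)
  · exact h.of_retract (AddMonoidAlgebra.lift D D S 1)
  · exact TowerRing.isDirectedUnionOfPolynomials.isPRINCDomain hD hsn
  · exact TowerRing.not_isCFD hD hsn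
  · obtain ⟨ε⟩ := TowerRing.exists_algHom (D := D)
    exact h.of_retract ε
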